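/- Let $G=(V,E)$ be a finite directed graph with a propagation probability $p_{(u,v)}\in[0,1]$ on each edge. There are $k+1$ cascades: the rumor $C_r$, with a fixed seed set $a_r\subseteq V$, and positive cascades $C_1,\dots,C_k$ generated by $k$ agents. The cascades have distinct priorities and the rumor has the highest one. Agent $i$ has an action space $\mathcal A_i\subseteq 2^V$. When the agents choose the full-action $A=(a_1,\dots,a_k)$, $a_i\in\mathcal A_i$, the P2P independent cascade (PIC) process runs as follows. At time $0$ each cascade activates its seeds; a node chosen by several cascades is activated by the one of highest priority. At each time step $t>0$, all active nodes act simultaneously and independently: each active node $u$ that has out-neighbors which it has not yet tried to activate selects one of them, $v$, uniformly at random (whether or not $v$ is already active), and this single attempt on $v$ succeeds with probability $p_{(u,v)}$. An inactive node that is successfully reached is activated by the cascade of highest priority among the cascades of the active nodes that successfully reached it in this step; a node once activated by a cascade remains activated by that cascade. The process ends when no active node has an untried out-neighbor (this happens within $|E|$ steps). Let $\gamma(A)$ be the expected number of nodes that are not activated by $C_r$, and $\sigma_i(A)$ the expected number of nodes that are activated by $C_i$. A strategy $s_i$ of agent $i$ is a probability distribution on $\mathcal A_i$. For a full-strategy $S=(s_1,\dots,s_k)$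 the agents draw their actions independently, so that $\Pr[A\mid S]=\prod_i s_i(a_i)$; the social utility is $\overline\gamma(S)=\sum_A\Pr[A\mid S]\,\gamma(A)$. In the rumor-oblivious game the private utility of agent $i$ is $\overline\sigma_i(S)=\sum_A\Pr[A\mid S]\,\sigma_i(A)$, and $S$ is a Nash equilibrium if $\overline\sigma_i(S)\ge\overline\sigma_i(S(i,s_i'))$ for every agent $i$ and every strategy $s_i'$ of agent $i$, where $S(i,s_i')$ is $S$ with $s_i$ replaced by $s_i'$. Let $S$ be a Nash equilibrium of the rumor-oblivious game. Then a full-strategy maximizing $\overline\gamma$ exists, and every full-strategy $\Omega$ that maximizes $\overline\gamma$ satisfies $$\overline\gamma(S)\ \ge\ \tfrac12\,\overline\gamma(\Omega).$$ -/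

import Mathlib

open scoped ENNReal

namespace RumorBlocking

section Probability

/-- The joint law of independent draws `a i ∼ P i`, `i ∈ ι`: the weight of `a` is
`∏ i, P i (a i)`. -/
noncomputable def indep {ι : Type*} [Fintype ι] [DecidableEq ι] {β : ι → Type*}
    [∀ i, Fintype (β i)] (P : ∀ i, PMF (β i)) : PMF (∀ i, β i) :=
  PMF.ofFintype (fun a => ∏ i, P i (a i)) (by
    rw [← Fintype.prod_sum]
    refine Finset.prod_eq_one fun i _ => ?_
    rw [← tsum_fintype (L := .unconditional _)]
    exact (P i).tsum_coe)

/-- A coin that shows `true` with probability `p` and `false` with probability `1 - p`. -/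
noncomputable def coin (p : unitInterval) : PMF Bool :=
  PMF.ofFintype
    (fun b => if b then ENNReal.ofReal (p : ℝ) else ENNReal.ofReal (1 - (p : ℝ))) (by
      rw [Fintype.sum_bool]
      simp only [if_true, Bool.false_eq_true, if_false]
      rw [← ENNReal.ofReal_add p.2.1 (sub_nonneg.2 p.2.2)]
      simp)

/-- The expectation of a real-valued function on a finite probability space. -/
noncomputable def expect {α : Type*} [Fintype α] (P : PMF α) (f : α → ℝ) : ℝ :=
  ∑ a, (P a).toReal * f a

end Probability

/-- The `k + 1` cascades: the rumor and one positive cascade for each of the `k` agents. -/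
inductive Cascade (k : ℕ) : Type
  | rumor : Cascade k
  | agent : Fin k → Cascade k
  deriving DecidableEq, Fintype

/-- The data of the rumor blocking game with `k` agents on the node set `V`.
The value `prob u v` is used only when `(u, v)` is an edge. -/
structure Game (V : Type*) (k : ℕ) where
  /-- the directed graph `G = (V, E)` -/
  graph : Digraph V
  /-- the propagation probability of each edge -/
  prob : V → V → unitInterval
  /-- the seed set of the rumor -/
  rumorSeeds : Finset V
  /-- the action space of each agent: the collection of seed sets that it can select -/
  actions : Fin k → Finset (Finset V)
  /-- the priority of each cascade; a larger value is a higher priority -/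
  priority : Cascade k → ℕ
  /-- different cascades have different priorities -/
  priority_injective : Function.Injective priority
  /-- the rumor has the highest priority -/
  priority_rumor : ∀ i, priority (.agent i) < priority .rumor

namespace Game

variable {V : Type*} [Fintype V] [DecidableEq V] {k : ℕ} (G : Game V k)

/-! ### The diffusion process -/

open Classical in
/-- The set `N_u` of the out-neighbors of `u`. -/
noncomputable def outNbrs (u : V) : Finset V := Finset.univ.filter fun v => G.graph.Adj u v

/-- The number of edges. -/
noncomputable def numEdges : ℕ := ∑ u, (G.outNbrs u).card

/-- The cascade of highest priority in `s` (`none` if `s` is empty). -/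
noncomputable def winner (s : Finset (Cascade k)) : Option (Cascade k) :=
  if h : s.Nonempty then some (s.exists_max_image G.priority h).choose else none

/-- A state of the diffusion process. -/
@[ext] structure State (V : Type*) (k : ℕ) where
  /-- `status u` is the cascade that activated `u`, or `none` while `u` is inactive -/
  status : V → Option (Cascade k)
  /-- `tried u` is the set of the nodes that `u` has already tried to activate -/
  tried : V → Finset V

/-- The set `b_u` of the out-neighbors of `u` that `u` has not yet tried to activate. -/
noncomputable def untried (s : State V k) (u : V) : Finset V := G.outNbrs u \ s.tried u

/-- What a node `u` does in one time step from the state `s`. If `u` is active and `b_u` is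
nonempty, then `u` selects `v ∈ b_u` uniformly at random and the attempt to activate `v` succeeds
with probability `prob u v`; this is recorded as `some (v, true)` (success) or `some (v, false)`
(failure). Otherwise `u` does nothing, recorded as `none`. -/
noncomputable def attempt (s : State V k) (u : V) : PMF (Option (V × Bool)) :=
  if h : (s.status u).isSome ∧ (G.untried s u).Nonempty then
    (PMF.uniformOfFinset (G.untried s u) h.2).bind fun v =>
      (coin (G.prob u v)).map fun b => some (v, b)
  else PMF.pure none

/-- The cascades that successfully reach `v` in a time step with attempts `o`. -/
def contenders (s : State V k) (o : V → Option (V × Bool)) (v : V) : Finset (Cascade k) :=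
  Finset.univ.filter fun c => ∃ u, s.status u = some c ∧ o u = some (v, true)

/-- The state after a time step with attempts `o` from the state `s`. An active node keeps its
status; an inactive node is activated by the cascade of highest priority that reaches it, if
there is one. -/
noncomputable def advance (s : State V k) (o : V → Option (V × Bool)) : State V k where
  status v := match s.status v with
    | some c => some c
    | none => G.winner (contenders s o v)
  tried u := s.tried u ∪ ((o u).map Prod.fst).toFinset

/-- One time step: all nodes act simultaneously and independently. -/
noncomputable def step (s : State V k) : PMF (State V k) :=
  (indep fun u => G.attempt s u).map (G.advance s)

/-- The seed set of each cascade when agent `i` selects `A i`. -/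
def seeds (A : Fin k → Finset V) : Cascade k → Finset V
  | .rumor => G.rumorSeeds
  | .agent i => A i

/-- Time step `0`: every seed is activated by the cascade of highest priority that selected it. -/
noncomputable def init (A : Fin k → Finset V) : State V k where
  status v := G.winner (Finset.univ.filter fun c => v ∈ G.seeds A c)
  tried _ := ∅

/-- The distribution of the state after time step `t`. -/
noncomputable def evolve (A : Fin k → Finset V) : ℕ → PMF (State V k)
  | 0 => PMF.pure (G.init A)
  | t + 1 => (evolve A t).bind G.step

/-- The distribution of the final status of the nodes. In each time step before the process has
ended, some edge is tried, and no edge is tried twice, so the process has ended after `|E|` time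
steps (see `evolve_numEdges_bind_step`). -/
noncomputable def outcome (A : Fin k → Finset V) : PMF (V → Option (Cascade k)) :=
  (G.evolve A G.numEdges).map State.status

/-! ### Utilities, strategies and equilibria -/

/-- `γ(A)`: the expected number of nodes that are not activated by the rumor under `A`. -/
noncomputable def gamma (A : Fin k → Finset V) : ℝ :=
  expect (G.outcome A) fun x => ((Finset.univ.filter fun v => x v ≠ some .rumor).card : ℝ)

/-- `σ_i(A)`: the expected number of nodes that are activated by the cascade of agent `i`
under `A`. -/
noncomputable def sigma (i : Fin k) (A : Fin k → Finset V) : ℝ :=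
  expect (G.outcome A) fun x => ((Finset.univ.filter fun v => x v = some (.agent i)).card : ℝ)

/-- A strategy of agent `i`: a probability distribution over its action space. -/
abbrev Strategy (i : Fin k) : Type _ := PMF {a : Finset V // a ∈ G.actions i}

/-- A full-strategy: a strategy for each agent. -/
abbrev FullStrategy : Type _ := ∀ i, G.Strategy i

/-- `Pr[A | S]`: the agents draw their actions independently. -/
noncomputable def actionLaw (S : G.FullStrategy) :
    PMF (∀ i, {a : Finset V // a ∈ G.actions i}) := indep S

/-- The social utility: the expected number of nodes not activated by the rumor under `S`. -/
noncomputable def socialUtility (S : G.FullStrategy) : ℝ :=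
  expect (G.actionLaw S) fun A => G.gamma fun i => (A i : Finset V)

/-- The private utility of agent `i` in the rumor-oblivious game: the expected number of nodes
activated by its own cascade under `S`. -/
noncomputable def obliviousUtility (i : Fin k) (S : G.FullStrategy) : ℝ :=
  expect (G.actionLaw S) fun A => G.sigma i fun j => (A j : Finset V)

/-- `S` is a (mixed) Nash equilibrium of the rumor-oblivious game. -/
def IsObliviousNash (S : G.FullStrategy) : Prop :=
  ∀ (i : Fin k) (s : G.Strategy i),
    G.obliviousUtility i (Function.update S i s) ≤ G.obliviousUtility i S

/-- `Ω` is a social optimum: it maximizes the social utility over all full-strategies. -/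
def IsSocialOptimum (Ω : G.FullStrategy) : Prop :=
  ∀ S : G.FullStrategy, G.socialUtility S ≤ G.socialUtility Ω

/-! ### The process has ended after `|E|` time steps -/

lemma attempt_idle (s : State V k) (u : V)
    (h : ¬ ((s.status u).isSome ∧ (G.untried s u).Nonempty)) :
    G.attempt s u = PMF.pure none := by
  simp [attempt, h]

lemma mem_untried_of_attempt {s : State V k} {u : V} {x : V × Bool}
    (h : some x ∈ (G.attempt s u).support) : x.1 ∈ G.untried s u := by
  unfold attempt at h
  split_ifs at h with h'
  · simp only [PMF.mem_support_bind_iff, PMF.mem_support_map_iff,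
      PMF.mem_support_uniformOfFinset_iff] at h
    obtain ⟨v, hv, b, -, hb⟩ := h
    simp only [Option.some.injEq] at hb
    subst hb
    exact hv
  · simp at h

lemma none_notMem_attempt {s : State V k} {u : V}
    (h' : (s.status u).isSome ∧ (G.untried s u).Nonempty) :
    none ∉ (G.attempt s u).support := by
  simp [attempt, h']

lemma mem_support_indep {ι : Type*} [Fintype ι] [DecidableEq ι] {β : ι → Type*}
    [∀ i, Fintype (β i)] (P : ∀ i, PMF (β i)) {a : ∀ i, β i}
    (h : a ∈ (indep P).support) (i : ι) : a i ∈ (P i).support := by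
  rw [PMF.mem_support_iff] at h ⊢
  intro h0
  exact h (by simpa [indep] using Finset.prod_eq_zero (Finset.mem_univ i) h0)

lemma indep_pure {ι : Type*} [Fintype ι] [DecidableEq ι] {β : ι → Type*}
    [∀ i, Fintype (β i)] (a : ∀ i, β i) :
    indep (fun i => PMF.pure (a i)) = PMF.pure a := by
  classical
  ext b
  simp only [indep, PMF.ofFintype_apply, PMF.pure_apply]
  by_cases hb : b = a
  · simp [hb]
  · rw [if_neg hb]
    obtain ⟨i, hi⟩ := Function.ne_iff.1 hb
    exact Finset.prod_eq_zero (Finset.mem_univ i) (by simp [hi])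

/-- No active node has an out-neighbor left to try. -/
def Quiescent (s : State V k) : Prop :=
  ∀ u, ¬ ((s.status u).isSome ∧ (G.untried s u).Nonempty)

lemma step_quiescent {s : State V k} (h : G.Quiescent s) : G.step s = PMF.pure s := by
  have h1 : (fun u => G.attempt s u) = fun u => PMF.pure ((fun _ => none : V → _) u) :=
    funext fun u => G.attempt_idle s u (h u)
  have h2 : G.advance s (fun _ => none) = s := by
    ext v x
    · have : contenders s (fun _ => none) v = ∅ := by
        simp [contenders]
      simp only [advance, this]
      cases hs : s.status v <;> simp [winner]
    · simp [advance]
  rw [step, h1, indep_pure, PMF.pure_map, h2]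

lemma evolve_progress (A : Fin k → Finset V) (t : ℕ) :
    ∀ s ∈ (G.evolve A t).support, (∀ u, s.tried u ⊆ G.outNbrs u) ∧
      (G.Quiescent s ∨ t ≤ ∑ u, (s.tried u).card) := by
  induction t with
  | zero =>
    intro s hs
    have : s = G.init A := by simpa [evolve] using hs
    subst this
    simp [init]
  | succ t ih =>
    intro s' hs'
    simp only [evolve, PMF.mem_support_bind_iff] at hs'
    obtain ⟨s, hs, hs'⟩ := hs'
    obtain ⟨hsub, hor⟩ := ih s hs
    by_cases hq : G.Quiescent s
    · rw [G.step_quiescent hq, PMF.mem_support_pure_iff] at hs'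
      subst hs'
      exact ⟨hsub, Or.inl hq⟩
    · have hle := hor.resolve_left hq
      simp only [step, PMF.mem_support_map_iff] at hs'
      obtain ⟨o, ho, rfl⟩ := hs'
      have hoo := fun u => mem_support_indep _ ho u
      refine ⟨fun u => ?_, Or.inr ?_⟩
      · refine Finset.union_subset (hsub u) fun v hv => ?_
        simp only [Option.mem_toFinset, Option.mem_def, Option.map_eq_some_iff] at hv
        obtain ⟨x, hx, rfl⟩ := hv
        have := G.mem_untried_of_attempt (hx ▸ hoo u)
        exact (Finset.mem_sdiff.1 this).1
      · unfold Quiescent at hq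
        push Not at hq
        obtain ⟨u, hu⟩ := hq
        refine Nat.succ_le_of_lt (lt_of_le_of_lt hle (Finset.sum_lt_sum (fun v _ => ?_)
          ⟨u, Finset.mem_univ u, ?_⟩))
        · exact Finset.card_le_card Finset.subset_union_left
        · refine Finset.card_lt_card (Finset.ssubset_iff_subset_ne.2
            ⟨Finset.subset_union_left, fun heq => ?_⟩)
          have hu' := hoo u
          cases hx : o u with
          | none => exact G.none_notMem_attempt hu (hx ▸ hu')
          | some x =>
            have h1 := (Finset.mem_sdiff.1 (G.mem_untried_of_attempt (hx ▸ hu'))).2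
            rw [heq] at h1
            exact h1 (Finset.mem_union_right _ (by simp [hx]))

/-- The distribution after `|E|` time steps does not change in further time steps. -/
theorem evolve_numEdges_bind_step (A : Fin k → Finset V) :
    (G.evolve A G.numEdges).bind G.step = G.evolve A G.numEdges := by
  have key : ∀ s ∈ (G.evolve A G.numEdges).support, G.step s = PMF.pure s := by
    intro s hs
    refine G.step_quiescent ?_
    obtain ⟨hsub, hq | hle⟩ := G.evolve_progress A _ s hs
    · exact hq
    · rintro u ⟨-, v, hv⟩
      obtain ⟨hv1, hv2⟩ := Finset.mem_sdiff.1 hv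
      refine absurd hle (not_le.2 (Finset.sum_lt_sum
        (fun w _ => Finset.card_le_card (hsub w)) ⟨u, Finset.mem_univ u, ?_⟩))
      exact Finset.card_lt_card ((Finset.ssubset_iff_of_subset (hsub u)).2 ⟨v, hv1, hv2⟩)
  conv_rhs => rw [← PMF.bind_pure (G.evolve A G.numEdges)]
  ext b
  simp only [PMF.bind_apply]
  refine tsum_congr fun s => ?_
  by_cases hs : s ∈ (G.evolve A G.numEdges).support
  · rw [key s hs]
  · rw [PMF.mem_support_iff, not_not] at hs
    simp [hs]

end Game

end RumorBlocking

/-! The game is smooth: for all full-actions `A` and `B`, `γ(B) ≤ γ(A) + ∑ i, σ_i(A with a_i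
replaced by b_i)` (`gamma_le_gamma_add_sum_sigma`). Fix `B` and average over `A ∼ S`. The Nash
condition against the pure deviation to `B i` bounds the sum by `∑ i, σ_i(S)`, which is at most
`γ(S)` (`sum_sigma_le_gamma`), so `γ(B) ≤ 2 γ(S)`. Averaging over `B ∼ Ω` gives the theorem.

Smoothness is proved by coupling. Each node draws in advance a script, the order of its attempts
together with their results, and reads one entry per step once it is active; this does not change
the law of the outcome (`scripts_map_finalStatus`). For fixed scripts, the times at which a cascade
can arrive at `v` depend on its own seeds only, and `v` goes to the cascade of highest priority
among the earliest arrivals (`replay_spec`). If `v` is lost to the rumor under `A` but not under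
`B`, then under `B` some agent `i` arrives strictly before the rumor. Under `A` nobody does, so `i`
wins `v` by switching alone (`exists_finalStatus_update`). -/

namespace RumorBlocking

/-! ### Independent draws from possibly infinite spaces, needed because scripts are lists. -/

section Product

lemma prod_tsum {ι β : Type*} [Fintype ι] (f : ι → β → ℝ≥0∞) :
    ∏ i, ∑' b, f i b = ∑' a : ι → β, ∏ i, f i (a i) := by
  refine Fintype.induction_empty_option
    (P := fun ι _ => ∀ f : ι → β → ℝ≥0∞, ∏ i, ∑' b, f i b = ∑' a : ι → β, ∏ i, f i (a i))
    (fun α γ _ e ih f => ?_) (fun f => by simp) (fun α _ ih f => ?_) ι f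
  · let := Fintype.ofEquiv γ e.symm
    rw [← e.prod_comp, ih (fun i => f (e i)), ← (Equiv.arrowCongr e (Equiv.refl β)).tsum_eq]
    refine tsum_congr fun a => ?_
    rw [← e.prod_comp]
    simp
  · rw [Fintype.prod_option, ih,
      ← (Equiv.piOptionEquivProd (β := fun _ : Option α => β)).symm.tsum_eq,
      ENNReal.tsum_prod', ← ENNReal.tsum_mul_right]
    refine tsum_congr fun b => ?_
    rw [← ENNReal.tsum_mul_left]
    refine tsum_congr fun a => ?_
    simp [Fintype.prod_option, Equiv.piOptionEquivProd]

variable {ι α β : Type*} [Fintype ι]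

/-- The joint law of independent draws `a i ∼ P i` from a space that need not be finite. -/
noncomputable def product (P : ι → PMF β) : PMF (ι → β) :=
  ⟨fun a => ∏ i, P i (a i), by
    rw [ENNReal.summable.hasSum_iff, ← prod_tsum]
    exact Finset.prod_eq_one fun i _ => (P i).tsum_coe⟩

lemma product_apply (P : ι → PMF β) (a : ι → β) : product P a = ∏ i, P i (a i) := rfl

lemma indep_eq_product [DecidableEq ι] [Fintype β] (P : ι → PMF β) :
    indep P = product P := rfl

/-- By Tonelli, independent two-stage draws can be made stage by stage. -/
lemma product_bind (P : ι → PMF α) (Q : ι → α → PMF β) :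
    product (fun i => (P i).bind (Q i)) = (product P).bind fun o => product fun i => Q i (o i) := by
  ext a
  simp only [product_apply, PMF.bind_apply, prod_tsum, Finset.prod_mul_distrib]

lemma product_pure (a : ι → β) : product (fun i => PMF.pure (a i)) = PMF.pure a := by
  classical
  ext b
  rw [product_apply, PMF.pure_apply]
  by_cases hb : b = a
  · simp [hb]
  · rw [if_neg hb]
    obtain ⟨i, hi⟩ := Function.ne_iff.1 hb
    exact Finset.prod_eq_zero (Finset.mem_univ i) (by simp [hi])

lemma product_map (P : ι → PMF α) (f : ι → α → β) :
    product (fun i => (P i).map (f i)) = (product P).map fun a i => f i (a i) := by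
  simp only [← PMF.bind_pure_comp, product_bind, Function.comp_def]
  exact congrArg _ (funext fun o => product_pure fun i => f i (o i))

end Product

lemma bind_congr_support {α β : Type*} {P : PMF α} {f g : α → PMF β}
    (h : ∀ a ∈ P.support, f a = g a) : P.bind f = P.bind g := by
  ext b
  simp only [PMF.bind_apply]
  refine tsum_congr fun a => ?_
  by_cases ha : a ∈ P.support
  · rw [h a ha]
  · rw [PMF.mem_support_iff, not_not] at ha
    simp [ha]

/-! ### Coordinatewise maps and expectations on finite spaces. -/

section Expectation

lemma indep_map {ι : Type*} [Fintype ι] [DecidableEq ι] {α β : ι → Type*}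
    [∀ i, Fintype (α i)] [∀ i, Fintype (β i)] (P : ∀ i, PMF (α i)) (f : ∀ i, α i → β i) :
    indep (fun i => (P i).map (f i)) = (indep P).map fun a i => f i (a i) := by
  classical
  ext b
  simp only [indep, PMF.ofFintype_apply, PMF.map_apply, tsum_fintype]
  rw [Fintype.prod_sum]
  refine Finset.sum_congr rfl fun a _ => ?_
  rw [Fintype.prod_ite_zero]
  simp only [funext_iff]

variable {α β : Type*} [Fintype α] [Fintype β]

lemma sum_toReal (P : PMF α) : ∑ a, (P a).toReal = 1 := by
  rw [← ENNReal.toReal_sum fun a _ => P.apply_ne_top a, ← tsum_fintype (L := .unconditional _),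
    P.tsum_coe]
  rfl

lemma expect_map (P : PMF α) (g : α → β) (f : β → ℝ) :
    expect (P.map g) f = expect P fun a => f (g a) := by
  classical
  have h : ∀ b, ((P.map g) b).toReal = ∑ a, if b = g a then (P a).toReal else 0 := fun b => by
    rw [PMF.map_apply, tsum_fintype, ENNReal.toReal_sum]
    · exact Finset.sum_congr rfl fun a _ => by split_ifs <;> rfl
    · intro a _
      split_ifs
      · exact P.apply_ne_top a
      · simp
  simp only [expect, h, Finset.sum_mul, ite_mul, zero_mul]
  rw [Finset.sum_comm]
  exact Finset.sum_congr rfl fun a _ => by simp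

lemma expect_mono {P : PMF α} {f g : α → ℝ} (h : ∀ a ∈ P.support, f a ≤ g a) :
    expect P f ≤ expect P g := by
  refine Finset.sum_le_sum fun a _ => ?_
  by_cases ha : a ∈ P.support
  · exact mul_le_mul_of_nonneg_left (h a ha) ENNReal.toReal_nonneg
  · rw [PMF.mem_support_iff, not_not] at ha
    simp [ha]

lemma expect_add (P : PMF α) (f g : α → ℝ) :
    expect P (fun a => f a + g a) = expect P f + expect P g := by
  simp [expect, mul_add, Finset.sum_add_distrib]

lemma expect_sum {ι : Type*} (s : Finset ι) (P : PMF α) (f : ι → α → ℝ) :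
    expect P (fun a => ∑ i ∈ s, f i a) = ∑ i ∈ s, expect P (f i) := by
  simp only [expect, Finset.mul_sum]
  exact Finset.sum_comm

lemma expect_const (P : PMF α) (c : ℝ) : expect P (fun _ => c) = c := by
  rw [expect, ← Finset.sum_mul, sum_toReal, one_mul]

lemma expect_pure (a : α) (f : α → ℝ) : expect (PMF.pure a) f = f a := by
  classical
  rw [expect, Finset.sum_eq_single a] <;> simp +contextual

end Expectation

namespace Game

variable {V : Type*} [Fintype V] [DecidableEq V] {k : ℕ} (G : Game V k)

/-! ### Scripts: all random choices of a node, drawn in advance -/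

/-- The law of the sequence of the next `n` attempts of `u` if its untried out-neighbors
are `b`. -/
noncomputable def scriptAux (u : V) : ℕ → Finset V → PMF (List (V × Bool))
  | 0, _ => PMF.pure []
  | n + 1, b =>
    if h : b.Nonempty then
      (PMF.uniformOfFinset b h).bind fun v =>
        ((coin (G.prob u v)).map fun c => some (v, c)).bind fun x =>
          (scriptAux u n (b.erase v)).map fun l => x.toList ++ l
    else PMF.pure []

/-- The law of the sequence of all attempts of `u` if its untried out-neighbors are `b`. -/
noncomputable def script (u : V) (b : Finset V) : PMF (List (V × Bool)) :=
  G.scriptAux u b.card b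

omit [Fintype V] in
lemma script_empty (u : V) : G.script u ∅ = PMF.pure [] := rfl

omit [Fintype V] in
-- The recursion counter of `scriptAux` is the cardinality of `b`, which drops by one with each
-- erased node, so it can be forgotten.
lemma script_of_nonempty (u : V) {b : Finset V} (h : b.Nonempty) :
    G.script u b = (PMF.uniformOfFinset b h).bind fun v =>
      ((coin (G.prob u v)).map fun c => some (v, c)).bind fun x =>
        (G.script u (b.erase v)).map fun l => x.toList ++ l := by
  obtain ⟨n, hn⟩ := Nat.exists_eq_succ_of_ne_zero h.card_pos.ne'
  rw [script, hn, scriptAux, dif_pos h]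
  refine bind_congr_support fun v hv => ?_
  rw [PMF.mem_support_uniformOfFinset_iff] at hv
  rw [script, Finset.card_erase_of_mem hv, hn, Nat.succ_sub_one]

/-- Read the next entry of the script of `u`, if `u` is active. -/
def act (x : V → Option (Cascade k)) (u : V) (l : List (V × Bool)) :
    Option (V × Bool) × List (V × Bool) :=
  if (x u).isSome then (l.head?, l.tail) else (none, l)

/-- Deferred decisions at one node: reading an entry amounts to making an attempt and keeping a
fresh script for the neighbors that remain. An inactive node reads nothing and its script stays
fresh. -/
lemma script_map_act (s : State V k) (u : V) :
    (G.script u (G.untried s u)).map (act s.status u) =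
      (G.attempt s u).bind fun o =>
        (G.script u (G.untried s u \ (o.map Prod.fst).toFinset)).map fun l => (o, l) := by
  by_cases h : (s.status u).isSome ∧ (G.untried s u).Nonempty
  · rw [script_of_nonempty G u h.2, attempt, dif_pos h, PMF.map_bind, PMF.bind_bind]
    refine congrArg _ (funext fun v => ?_)
    rw [PMF.map_bind, PMF.bind_map, PMF.bind_map]
    refine congrArg _ (funext fun c => ?_)
    simp only [Function.comp_apply, PMF.map_comp, Option.map_some, Option.toFinset_some,
      Finset.sdiff_singleton_eq_erase]
    congr 1
    funext l
    simp [act, h.1]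
  · rw [attempt_idle G s u h, PMF.pure_bind]
    simp only [Option.map_none, Option.toFinset_none, Finset.sdiff_empty]
    by_cases h1 : (s.status u).isSome
    · have h2 : G.untried s u = ∅ := Finset.not_nonempty_iff_eq_empty.1 fun h2 => h ⟨h1, h2⟩
      simp [h2, script_empty, PMF.pure_map, act, h1]
    · congr 1
      funext l
      simp [act, h1]

/-- One time step of the process in which the nodes follow their scripts. -/
noncomputable def replayStep (x : (V → Option (Cascade k)) × (V → List (V × Bool))) :
    (V → Option (Cascade k)) × (V → List (V × Bool)) :=
  -- The empty `tried` sets are dummies: the new status does not depend on them.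
  ((G.advance ⟨x.1, fun _ => ∅⟩ fun u => (act x.1 u (x.2 u)).1).status,
    fun u => (act x.1 u (x.2 u)).2)

/-- The status of the nodes and the unread parts of the scripts `r` after time step `t`. -/
noncomputable def replay (A : Fin k → Finset V) (r : V → List (V × Bool)) :
    ℕ → (V → Option (Cascade k)) × (V → List (V × Bool))
  | 0 => ((G.init A).status, r)
  | t + 1 => G.replayStep (replay A r t)

/-- The law of the unread parts of the scripts in the state `s`. -/
noncomputable def scriptsFrom (s : State V k) : PMF (V → List (V × Bool)) :=
  product fun u => G.script u (G.untried s u)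

/-- The law of the scripts at the start of the process. -/
noncomputable def scripts : PMF (V → List (V × Bool)) :=
  product fun u => G.script u (G.outNbrs u)

lemma untried_advance (s : State V k) (o : V → Option (V × Bool)) (u : V) :
    G.untried (G.advance s o) u = G.untried s u \ ((o u).map Prod.fst).toFinset :=
  sdiff_sdiff_left.symm

lemma scriptsFrom_map_replayStep (s : State V k) :
    (G.scriptsFrom s).map (fun r => G.replayStep (s.status, r)) =
      (G.step s).bind fun s' => (G.scriptsFrom s').map fun r => (s'.status, r) := by
  have h := product_map (fun u => G.script u (G.untried s u)) (act s.status)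
  simp only [script_map_act, product_bind, product_map] at h
  have h' := congrArg (PMF.map fun p : V → Option (V × Bool) × List (V × Bool) =>
    ((G.advance s fun u => (p u).1).status, fun u => (p u).2)) h
  rw [PMF.map_comp, PMF.map_bind] at h'
  refine Eq.trans ?_ (h'.symm.trans ?_)
  · rfl
  · rw [step, indep_eq_product, PMF.bind_map]
    refine congrArg _ (funext fun o => ?_)
    rw [PMF.map_comp]
    simp only [Function.comp_apply, scriptsFrom, untried_advance]
    rfl

/-- Given the state, the unread scripts are again independent and fresh, which is what lets the
one-step identity be iterated. -/
lemma scripts_map_replay (A : Fin k → Finset V) (t : ℕ) :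
    G.scripts.map (fun r => G.replay A r t) =
      (G.evolve A t).bind fun s => (G.scriptsFrom s).map fun r => (s.status, r) := by
  induction t with
  | zero =>
    simp only [evolve, PMF.pure_bind, scripts, scriptsFrom, untried, init, Finset.sdiff_empty]
    rfl
  | succ t ih =>
    have h := congrArg (PMF.map G.replayStep) ih
    rw [PMF.map_comp, PMF.map_bind] at h
    refine Eq.trans ?_ (h.trans ?_)
    · rfl
    · rw [evolve, PMF.bind_bind]
      refine congrArg _ (funext fun s => ?_)
      rw [← scriptsFrom_map_replayStep, PMF.map_comp]
      rfl

/-- The status of the nodes at the end of the process if the nodes follow the scripts `r`. -/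
noncomputable def finalStatus (r : V → List (V × Bool)) (A : Fin k → Finset V) :
    V → Option (Cascade k) := (G.replay A r G.numEdges).1

lemma scripts_map_finalStatus (A : Fin k → Finset V) :
    G.scripts.map (fun r => G.finalStatus r A) = G.outcome A := by
  have h := congrArg (PMF.map Prod.fst) (G.scripts_map_replay A G.numEdges)
  rw [PMF.map_comp, PMF.map_bind] at h
  refine Eq.trans ?_ (h.trans ?_)
  · rfl
  · rw [outcome, ← PMF.bind_pure_comp]
    refine congrArg _ (funext fun s => ?_)
    rw [PMF.map_comp]
    exact PMF.map_const _ _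

/-! ### Arrival times in the scripted process -/

/-- `Reaches r X t v`: under the scripts `r`, a cascade with the seed set `X` can arrive at `v`
at time `t`. -/
inductive Reaches (r : V → List (V × Bool)) (X : Finset V) : ℕ → V → Prop
  | seed {v : V} (h : v ∈ X) : Reaches r X 0 v
  | trans {t j : ℕ} {u v : V} (h : Reaches r X t u) (hj : (r u)[j]? = some (v, true)) :
      Reaches r X (t + j + 1) v

omit [Fintype V] [DecidableEq V] in
lemma winner_eq_none {s : Finset (Cascade k)} : G.winner s = none ↔ s = ∅ := by
  unfold winner
  split_ifs with h
  · simp [h.ne_empty]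
  · simp [Finset.not_nonempty_iff_eq_empty.1 h]

omit [Fintype V] [DecidableEq V] in
lemma winner_eq_some {s : Finset (Cascade k)} {c : Cascade k} (h : G.winner s = some c) :
    c ∈ s ∧ ∀ c' ∈ s, G.priority c' ≤ G.priority c := by
  unfold winner at h
  split_ifs at h with hs
  · obtain rfl := Option.some.inj h
    exact (s.exists_max_image G.priority hs).choose_spec

/-- Cascade `c` is the one of highest priority among those that arrive at `v` first, and it
arrives at time `t`. -/
structure Wins (A : Fin k → Finset V) (r : V → List (V × Bool)) (t : ℕ) (v : V)
    (c : Cascade k) : Prop where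
  reaches : Reaches r (G.seeds A c) t v
  first : ∀ t' < t, ∀ c', ¬ Reaches r (G.seeds A c') t' v
  highest : ∀ c', Reaches r (G.seeds A c') t v → G.priority c' ≤ G.priority c

omit [Fintype V] [DecidableEq V] in
lemma Wins.le {G : Game V k} {A : Fin k → Finset V} {r : V → List (V × Bool)} {t t' : ℕ} {v : V}
    {c c' : Cascade k} (h : G.Wins A r t v c) (h' : Reaches r (G.seeds A c') t' v) : t ≤ t' :=
  not_lt.1 fun hlt => h.first t' hlt c' h'

/-- A node activated at time `τ` reads entry `j` of its script in step `τ + j + 1`; hence the shift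
in `Reaches` and the `drop (t - τ)`. -/
lemma replay_spec (A : Fin k → Finset V) (r : V → List (V × Bool)) (t : ℕ) (v : V) :
    (∃ τ ≤ t, ∃ c, G.Wins A r τ v c ∧ (G.replay A r t).1 v = some c ∧
        (G.replay A r t).2 v = (r v).drop (t - τ)) ∨
      ((∀ τ ≤ t, ∀ c, ¬ Reaches r (G.seeds A c) τ v) ∧ (G.replay A r t).1 v = none ∧
        (G.replay A r t).2 v = r v) := by
  induction t generalizing v with
  | zero =>
    have h0 : ∀ c, Reaches r (G.seeds A c) 0 v ↔ v ∈ G.seeds A c :=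
      fun c => ⟨fun h => by cases h; assumption, .seed⟩
    cases hw : (G.init A).status v with
    | some c =>
      obtain ⟨h1, h2⟩ := G.winner_eq_some hw
      simp only [Finset.mem_filter, Finset.mem_univ, true_and] at h1 h2
      exact .inl ⟨0, le_rfl, c, ⟨.seed h1, by simp, fun c' hc' => h2 c' ((h0 c').1 hc')⟩, hw, rfl⟩
    | none =>
      have h1 := Finset.filter_eq_empty_iff.1 (G.winner_eq_none.1 hw)
      refine .inr ⟨fun τ hτ c hc => ?_, hw, rfl⟩
      obtain rfl := Nat.le_zero.1 hτ
      exact h1 (Finset.mem_univ c) ((h0 c).1 hc)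
  | succ t ih =>
    rcases ih v with ⟨τ, hτ, c, hw, hs, hr⟩ | ⟨hn, hs, hr⟩
    · refine .inl ⟨τ, by omega, c, hw, ?_, ?_⟩
      · simp [replay, replayStep, advance, hs]
      · simp [replay, replayStep, act, hs, hr, Nat.sub_add_comm hτ]
    set x := G.replay A r t with hx
    have hr' : (G.replay A r (t + 1)).2 v = r v := by
      simp [replay, replayStep, act, ← hx, hs, hr]
    have hs' : (G.replay A r (t + 1)).1 v = G.winner (contenders ⟨x.1, fun _ => ∅⟩
        (fun u => (act x.1 u (x.2 u)).1) v) := by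
      simp [replay, replayStep, advance, ← hx, hs]
    set K := contenders ⟨x.1, fun _ => ∅⟩ (fun u => (act x.1 u (x.2 u)).1) v with hK
    have hmem : ∀ c, c ∈ K ↔ ∃ u, ∃ τ ≤ t, G.Wins A r τ u c ∧
        (r u)[t - τ]? = some (v, true) := by
      intro c
      simp only [hK, contenders, Finset.mem_filter, Finset.mem_univ, true_and]
      refine exists_congr fun u => ?_
      rcases ih u with ⟨τ₀, hτ₀, c₀, hw, hs₀, hr₀⟩ | ⟨hn', hs₀, -⟩
      · simp only [act, hs₀, hr₀, Option.isSome_some, if_true, List.head?_drop, Option.some.injEq]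
        constructor
        · rintro ⟨rfl, h⟩
          exact ⟨τ₀, hτ₀, hw, h⟩
        · rintro ⟨τ, -, hw', h⟩
          obtain rfl : τ₀ = τ := le_antisymm (hw.le hw'.reaches) (hw'.le hw.reaches)
          exact ⟨G.priority_injective (le_antisymm (hw'.highest _ hw.reaches)
            (hw.highest _ hw'.reaches)), h⟩
      · simp only [hs₀, reduceCtorEq, false_and, false_iff]
        rintro ⟨τ, hτ, hw, -⟩
        exact hn' τ hτ c hw.reaches
    have h1 : ∀ c ∈ K, Reaches r (G.seeds A c) (t + 1) v := by
      intro c hc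
      obtain ⟨u, τ, hτ, hw, hl⟩ := (hmem c).1 hc
      have := hw.reaches.trans hl
      rwa [Nat.add_sub_cancel' hτ] at this
    -- `K` can miss a cascade that could arrive now but was beaten at `u`; the one that beat it is
    -- in `K` with at least its priority, so the winner is unaffected.
    have h2 : ∀ c, Reaches r (G.seeds A c) (t + 1) v → ∃ c' ∈ K, G.priority c ≤ G.priority c' := by
      intro c hc
      generalize ht' : t + 1 = t' at hc
      cases hc with
      | seed h => omega
      | @trans τ j u _ hu hj =>
        have hτ : τ + j = t := by omega
        rcases ih u with ⟨τ₀, hτ₀, c₀, hw, -, -⟩ | ⟨hn', -, -⟩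
        · have hle := hw.le hu
          -- Had `u` been activated before `τ`, its winner would have arrived at `v` by time `t`.
          have heq : τ₀ = τ := by
            by_contra hne
            exact hn (τ₀ + j + 1) (by omega) c₀ (hw.reaches.trans hj)
          subst heq
          refine ⟨c₀, (hmem c₀).2 ⟨u, τ₀, hτ₀, hw, ?_⟩, hw.highest c hu⟩
          rw [← hτ, Nat.add_sub_cancel_left, hj]
        · exact absurd hu (hn' τ (by omega) c)
    cases hwin : G.winner K with
    | some c =>
      obtain ⟨h3, h4⟩ := G.winner_eq_some hwin
      refine .inl ⟨t + 1, le_rfl, c, ⟨h1 c h3, fun t' ht' => hn t' (by omega), fun c' hc' => ?_⟩,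
        hs'.trans hwin, by simp [hr']⟩
      obtain ⟨c'', hc'', hle⟩ := h2 c' hc'
      exact hle.trans (h4 c'' hc'')
    | none =>
      have hemp := G.winner_eq_none.1 hwin
      refine .inr ⟨fun τ hτ c hc => ?_, hs'.trans hwin, hr'⟩
      rcases Nat.lt_or_ge t τ with h | h
      · obtain rfl : τ = t + 1 := by omega
        obtain ⟨c', hc', -⟩ := h2 c hc
        simp [hemp] at hc'
      · exact hn τ h c hc

lemma finalStatus_eq_some_iff {A : Fin k → Finset V} {r : V → List (V × Bool)} {v : V}
    {c : Cascade k} :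
    G.finalStatus r A v = some c ↔ ∃ τ ≤ G.numEdges, G.Wins A r τ v c := by
  rcases G.replay_spec A r G.numEdges v with ⟨τ, hτ, c₀, hw, hs, -⟩ | ⟨hn, hs, -⟩
  · rw [finalStatus, hs, Option.some.injEq]
    constructor
    · rintro rfl
      exact ⟨τ, hτ, hw⟩
    · rintro ⟨τ', hτ', hw'⟩
      obtain rfl : τ = τ' := le_antisymm (hw.le hw'.reaches) (hw'.le hw.reaches)
      exact G.priority_injective (le_antisymm (hw'.highest _ hw.reaches) (hw.highest _ hw'.reaches))
  · rw [finalStatus, hs]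
    constructor
    · simp
    · rintro ⟨τ, hτ, hw⟩
      exact absurd hw.reaches (hn τ hτ c)

/-- A node that the rumor activates under `A` but not under `B` is activated by some agent `i`
when `i` alone changes its action in `A` to the one in `B`. -/
lemma exists_finalStatus_update {A B : Fin k → Finset V} {r : V → List (V × Bool)} {v : V}
    (hA : G.finalStatus r A v = some .rumor) (hB : G.finalStatus r B v ≠ some .rumor) :
    ∃ i, G.finalStatus r (Function.update A i (B i)) v = some (.agent i) := by
  obtain ⟨τ, hτ, hw⟩ := G.finalStatus_eq_some_iff.1 hA
  rcases G.replay_spec B r G.numEdges v with ⟨τ', hτ', c, hw', hs, -⟩ | ⟨hn, -, -⟩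
  · have hle : τ' ≤ τ := hw'.le (c' := .rumor) hw.reaches
    -- In a tie the rumor would win by priority.
    have hlt : τ' < τ := by
      refine lt_of_le_of_ne hle fun heq => hB (hs.trans (congrArg some ?_))
      subst heq
      have := hw'.highest .rumor hw.reaches
      cases c with
      | rumor => rfl
      | agent i => exact absurd this (not_le.2 (G.priority_rumor i))
    cases c with
    | rumor => exact absurd hw'.reaches (hw.first τ' hlt .rumor)
    | agent i =>
      refine ⟨i, G.finalStatus_eq_some_iff.2 ⟨τ', hτ', ?_⟩⟩
      have hne : ∀ c, c ≠ .agent i →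
          G.seeds (Function.update A i (B i)) c = G.seeds A c := by
        intro c hc
        cases c with
        | rumor => rfl
        | agent j => simp [seeds, Function.update_of_ne (fun h : j = i => hc (h ▸ rfl))]
      have heq : G.seeds (Function.update A i (B i)) (.agent i) = G.seeds B (.agent i) := by
        simp [seeds]
      refine ⟨heq ▸ hw'.reaches, fun t ht c => ?_, fun c hc => ?_⟩
      · by_cases hc : c = .agent i
        · subst hc
          exact heq ▸ hw'.first t ht _
        · exact hne c hc ▸ hw.first t (ht.trans hlt) c
      · by_cases hci : c = .agent i
        · rw [hci]
        -- Any other cascade has its seeds from `A`, hence cannot arrive before `τ`.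
        · exact absurd (hne c hci ▸ hc) (hw.first τ' hlt c)
  · exact absurd hw.reaches (hn τ hτ .rumor)

/-! ### The smoothness of the rumor-oblivious game -/

/-- The joint law of the outcomes of all full-actions when the nodes follow common scripts. -/
noncomputable def coupling : PMF ((Fin k → Finset V) → V → Option (Cascade k)) :=
  G.scripts.map G.finalStatus

/-- The scripts range over an infinite type, but `coupling` lives on a finite one, where `expect`
makes sense and all full-actions can be compared pointwise. -/
lemma expect_outcome (A : Fin k → Finset V) (f : (V → Option (Cascade k)) → ℝ) :
    expect (G.outcome A) f = expect G.coupling fun x => f (x A) := by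
  rw [← expect_map G.coupling (fun x => x A) f, coupling, PMF.map_comp,
    ← scripts_map_finalStatus]
  rfl

/-- The loss of social utility when the agents play `A` instead of `B` is at most the sum of what
the agents obtain by deviating from `A` to `B` one at a time. -/
lemma gamma_le_gamma_add_sum_sigma (A B : Fin k → Finset V) :
    G.gamma B ≤ G.gamma A + ∑ i, G.sigma i (Function.update A i (B i)) := by
  simp only [gamma, sigma, expect_outcome]
  rw [← expect_sum, ← expect_add]
  refine expect_mono fun x hx => ?_
  simp only [coupling, PMF.mem_support_map_iff] at hx
  obtain ⟨r, -, rfl⟩ := hx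
  norm_cast
  refine (Finset.card_le_card fun v hv => ?_).trans ((Finset.card_union_le _ (Finset.univ.biUnion
    fun i => Finset.univ.filter fun v =>
      G.finalStatus r (Function.update A i (B i)) v = some (.agent i))).trans
    (add_le_add_right Finset.card_biUnion_le _))
  simp only [Finset.mem_union, Finset.mem_biUnion, Finset.mem_filter, Finset.mem_univ,
    true_and] at hv ⊢
  by_cases hA : G.finalStatus r A v = some .rumor
  · exact .inr (G.exists_finalStatus_update hA hv)
  · exact .inl hA

/-- The nodes won by different agents form disjoint sets, none of which meets the rumor's. -/
lemma sum_sigma_le_gamma (A : Fin k → Finset V) : ∑ i, G.sigma i A ≤ G.gamma A := by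
  simp only [gamma, sigma]
  rw [← expect_sum]
  refine expect_mono fun x _ => ?_
  norm_cast
  rw [← Finset.card_biUnion]
  · refine Finset.card_le_card fun v hv => ?_
    simp only [Finset.mem_biUnion, Finset.mem_filter, Finset.mem_univ, true_and] at hv ⊢
    obtain ⟨i, hi⟩ := hv
    simp [hi]
  · intro i _ j _ hij
    refine Finset.disjoint_left.2 ?_
    intro v hi hj
    simp only [Finset.mem_filter, Finset.mem_univ, true_and] at hi hj
    rw [hi] at hj
    simp only [Option.some.injEq, Cascade.agent.injEq] at hj
    exact hij hj

/-! ### Equilibria -/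

omit [Fintype V] [DecidableEq V] in
lemma actionLaw_update_pure (S : G.FullStrategy) (i : Fin k)
    (b : {a : Finset V // a ∈ G.actions i}) :
    G.actionLaw (Function.update S i (PMF.pure b)) =
      (G.actionLaw S).map fun A => Function.update A i b := by
  -- The coordinate map is constant at `i` and the identity elsewhere.
  have h := indep_map S fun j a => if hj : j = i then hj ▸ b else a
  have h1 : (fun j => (S j).map fun a => if hj : j = i then hj ▸ b else a) =
      Function.update S i (PMF.pure b) := by
    funext j
    by_cases hj : j = i
    · subst hj
      simp only [dite_true, Function.update_self]
      exact PMF.map_const _ _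
    · simp only [hj, dite_false, ne_eq, not_false_eq_true, Function.update_of_ne]
      exact PMF.map_id _
  have h2 : (fun (A : ∀ j, {a : Finset V // a ∈ G.actions j}) j =>
      if hj : j = i then hj ▸ b else A j) = fun A => Function.update A i b := by
    funext A j
    by_cases hj : j = i
    · subst hj
      simp
    · simp [hj]
  rw [h1, h2] at h
  exact h

lemma gamma_le_two_mul_socialUtility {S : G.FullStrategy} (hS : G.IsObliviousNash S)
    (B : ∀ i, {a : Finset V // a ∈ G.actions i}) :
    G.gamma (fun i => (B i : Finset V)) ≤ 2 * G.socialUtility S := by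
  have h1 : ∀ i, expect (G.actionLaw S) (fun A =>
      G.sigma i (Function.update (fun j => (A j : Finset V)) i (B i))) ≤
        G.obliviousUtility i S := by
    intro i
    refine le_trans (le_of_eq ?_) (hS i (PMF.pure (B i)))
    rw [obliviousUtility, actionLaw_update_pure, expect_map]
    congr 1
    funext A
    congr 1
    funext j
    by_cases hj : j = i
    · subst hj
      simp
    · simp [hj]
  have h2 : ∑ i, G.obliviousUtility i S ≤ G.socialUtility S := by
    simp only [obliviousUtility, socialUtility]
    rw [← expect_sum]
    exact expect_mono fun A _ => G.sum_sigma_le_gamma _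
  calc G.gamma (fun i => (B i : Finset V))
      = expect (G.actionLaw S) fun _ => G.gamma fun i => (B i : Finset V) :=
        (expect_const _ _).symm
    _ ≤ expect (G.actionLaw S) fun A => G.gamma (fun j => (A j : Finset V)) +
          ∑ i, G.sigma i (Function.update (fun j => (A j : Finset V)) i (B i)) :=
        expect_mono fun A _ => G.gamma_le_gamma_add_sum_sigma _ _
    _ = G.socialUtility S + ∑ i, expect (G.actionLaw S) (fun A =>
          G.sigma i (Function.update (fun j => (A j : Finset V)) i (B i))) := by
        rw [expect_add, expect_sum, socialUtility]
    _ ≤ G.socialUtility S + G.socialUtility S :=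
        add_le_add_right ((Finset.sum_le_sum fun i _ => h1 i).trans h2) _
    _ = 2 * G.socialUtility S := (two_mul _).symm

/-- The social utility averages `γ` over finitely many full-actions, so playing a best one with
certainty is optimal. -/
lemma exists_isSocialOptimum (S : G.FullStrategy) :
    ∃ Ω : G.FullStrategy, G.IsSocialOptimum Ω := by
  -- The given `S` ensures that a full-action exists.
  obtain ⟨A₀, -⟩ := (G.actionLaw S).support_nonempty
  obtain ⟨B, -, hB⟩ := Finset.exists_max_image Finset.univ
    (fun A : ∀ i, {a : Finset V // a ∈ G.actions i} => G.gamma fun i => (A i : Finset V))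
    ⟨A₀, Finset.mem_univ _⟩
  refine ⟨fun i => PMF.pure (B i), fun T => ?_⟩
  calc G.socialUtility T
      ≤ expect (G.actionLaw T) fun _ => G.gamma fun i => (B i : Finset V) :=
        expect_mono fun A _ => hB A (Finset.mem_univ A)
    _ = G.gamma fun i => (B i : Finset V) := expect_const _ _
    _ = G.socialUtility fun i => PMF.pure (B i) := by
        rw [socialUtility, actionLaw, indep_pure, expect_pure]

end Game
end RumorBlocking

theorem mainTheorem10 {V : Type*} [Fintype V] [DecidableEq V] {k : ℕ}
    (G : RumorBlocking.Game V k) (S : G.FullStrategy) (hS : G.IsObliviousNash S) :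
    (∃ Ω : G.FullStrategy, G.IsSocialOptimum Ω) ∧
      ∀ Ω : G.FullStrategy, G.IsSocialOptimum Ω →
        (1 / 2 : ℝ) * G.socialUtility Ω ≤ G.socialUtility S := by
  refine ⟨G.exists_isSocialOptimum S, fun Ω _ => ?_⟩
  have h : G.socialUtility Ω ≤ 2 * G.socialUtility S :=
    (RumorBlocking.expect_mono fun B _ => G.gamma_le_two_mul_socialUtility hS B).trans_eq
      (RumorBlocking.expect_const _ _)
  linarith
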